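/- Theorem (Vitali). Let $\Omega$ be an open connected subset of $\mathbb{C}$ (resp. of $\mathbb{R}^d$), and let $X$ be a complex (resp. real) Banach space. Call $f:\Omega\to X$ holomorphic if it is complex differentiable at every point of $\Omega$, and harmonic if it is twice continuously differentiable with $\Delta f=0$ on $\Omega$. A subset $N\subset\Omega$ is called a set of uniqueness for holomorphic (resp. harmonic) functions if every holomorphic function $h:\Omega\to\mathbb{C}$ (resp. harmonic function $h:\Omega\to\mathbb{R}$) that vanishes on $N$ vanishes on all of $\Omega$. Let $(f_n)_{n\in\mathbb{N}}$ be a sequence of holomorphic (resp. harmonic) functions $f_n:\Omega\to X$ that is locally $L^1$-bounded, i.e. there is a function $g\in L^1_{\mathrm{loc}}(\Omega,\mathbb{R})$ such that $\|f_n(\xi)\|_X\le g(\xi)$ for every $n$ and almost every $\xi\in\Omega$. Suppose that $N\subset\Omega$ is a set of uniqueness for holomorphic (resp. harmonic) functions and that $\lim_{n\to\infty}f_n(\xi)$ exists in $X$ for every $\xi\in N$. Then there is a holomorphic (resp. harmonic) function $f:\Omega\to X$ such that $f_n\to f$ uniformly on every compact subset of $\Omega$. -/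

import Mathlib

open Filter Topology MeasureTheory

/-- A sequence `f` of `X`-valued functions on the open set `Ω` is locally `L¹`-bounded if one single
real function `g ∈ L¹_loc(Ω)` dominates the norms of all `f n` almost everywhere on `Ω`. -/
def LocallyL1Bounded {E : Type*} [TopologicalSpace E] [MeasureSpace E]
    {X : Type*} [NormedAddCommGroup X] (f : ℕ → E → X) (Ω : Set E) : Prop :=
  ∃ g : E → ℝ, LocallyIntegrableOn g Ω volume ∧
    ∀ n, ∀ᵐ ξ ∂(volume.restrict Ω), ‖f n ξ‖ ≤ g ξ

/-- `N ⊆ Ω` is a set of uniqueness for holomorphic functions on the open set `Ω ⊆ ℂ`: every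
holomorphic function on `Ω` that vanishes on `N` vanishes on `Ω`. -/
def IsHolomorphicUniquenessSet (N Ω : Set ℂ) : Prop :=
  N ⊆ Ω ∧ ∀ h : ℂ → ℂ, DifferentiableOn ℂ h Ω → (∀ z ∈ N, h z = 0) → ∀ z ∈ Ω, h z = 0

/-- `N ⊆ Ω` is a set of uniqueness for harmonic functions on the open set `Ω ⊆ ℝᵈ`: every
harmonic function on `Ω` that vanishes on `N` vanishes on `Ω`. -/
def IsHarmonicUniquenessSet {d : ℕ} (N Ω : Set (EuclideanSpace ℝ (Fin d))) : Prop :=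
  N ⊆ Ω ∧ ∀ h : EuclideanSpace ℝ (Fin d) → ℝ, InnerProductSpace.HarmonicOnNhd h Ω →
    (∀ ξ ∈ N, h ξ = 0) → ∀ ξ ∈ Ω, h ξ = 0

/-!
Vitali's theorem for functions with values in a Banach space `X`, where Montel's compactness
argument is not available.

The sequence `(f n)` is regarded as one function `F` with values in the Banach space `ℕ →ᵇ X` of
bounded sequences. If `F` is holomorphic (harmonic), then so is `φ ∘ F` for each continuous
functional `φ` annihilating the closed subspace `c(X)` of convergent sequences
(`convergentSequences`). Since `F` takes values in `c(X)` on `N`, the function `φ ∘ F` vanishes on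
`N`, hence on `Ω`, and Hahn–Banach (`mem_convergentSequences_of_forall_dual`) shows that `F` takes
values in `c(X)` on all of `Ω`. So `f n` converges pointwise on `Ω`; continuity of `F` is
equicontinuity of the `f n`, and makes the convergence locally uniform. In the harmonic case the
limit is the image of `F` under the continuous linear map `limCLM : c(X) → X`, hence harmonic.

It remains to see that `F` exists and is holomorphic (harmonic). Harmonic functions are reproduced
by convolution with a compactly supported radial kernel (`exists_reproducing_kernel`). This is the
mean value property `InnerProductSpace.HarmonicOnNhd.integral_radial_smul`, proved by showing
through integration by parts that the weighted average of `y ↦ f (x + t y)` does not depend on `t`.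
The kernel converts the local `L¹` bound into local uniform bounds and Lipschitz estimates
(`exists_uniform_bound_of_locallyIntegrableOn`; holomorphic functions are harmonic), so `F` is
well defined and continuous. Reproduction by the kernel, or by the Cauchy integral, can be checked
coordinate by coordinate and gives the regularity of `F`
(`ContinuousOn.harmonicOnNhd_of_separating`, `ContinuousOn.differentiableOn_complex_of_separating`).
-/

section

open InnerProductSpace Laplacian Metric

/-! ### Mean value property with radial weights -/

section MeanValue

variable {E : Type*} [NormedAddCommGroup E] [InnerProductSpace ℝ E]

theorem hasCompactSupport_comp_norm_sq [FiniteDimensional ℝ E] {χ : ℝ → ℝ} {r : ℝ} (hr : 0 ≤ r)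
    (h0 : ∀ s, r ^ 2 ≤ s → χ s = 0) : HasCompactSupport fun y : E ↦ χ (‖y‖ ^ 2) := by
  refine HasCompactSupport.intro (isCompact_closedBall (0 : E) r) fun y hy ↦ h0 _ ?_
  have : r < ‖y‖ := by simpa using hy
  gcongr

/-- A radial weight times `y` is half the gradient of a radial function that vanishes where the
weight does; the potential is a primitive of the profile based at `r ^ 2`. -/
theorem exists_primitive_comp_norm_sq {χ : ℝ → ℝ} (hχ : Continuous χ) {r : ℝ}
    (h0 : ∀ s, r ^ 2 ≤ s → χ s = 0) :
    ∃ η : ℝ → ℝ, (∀ s, r ^ 2 ≤ s → η s = 0) ∧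
      ∀ y : E, HasFDerivAt (fun y : E ↦ η (‖y‖ ^ 2)) ((2 * χ (‖y‖ ^ 2)) • innerSL ℝ y) y := by
  refine ⟨fun s ↦ ∫ t in (r ^ 2)..s, χ t, fun s hs ↦ ?_, fun y ↦ ?_⟩
  · rw [← intervalIntegral.integral_zero (a := r ^ 2) (b := s)]
    refine intervalIntegral.integral_congr fun t ht ↦ h0 t ?_
    rw [Set.uIcc_of_le hs] at ht
    exact ht.1
  · have h := ((hχ.integral_hasStrictDerivAt (r ^ 2) (‖y‖ ^ 2)).hasDerivAt).comp_hasFDerivAt y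
      (hasStrictFDerivAt_norm_sq y).hasFDerivAt
    convert! h using 1
    ext v
    simp
    ring

variable [FiniteDimensional ℝ E] [MeasurableSpace E] [BorelSpace E] (μ : Measure E)
  [μ.IsAddHaarMeasure] {Z : Type*} [NormedAddCommGroup Z] [NormedSpace ℝ Z]

/-- The derivative in the scale `t` of the weighted average of `g` vanishes: writing the weight
times `y` as a gradient `∇ψ / 2` with `ψ` supported in the ball and integrating by parts turns the
integral into a multiple of `∫ ψ(y) Δg(ty) dy`. -/
theorem integral_radial_smul_fderiv_eq_zero {χ : ℝ → ℝ} (hχ : Continuous χ) {r : ℝ} (hr : 0 < r)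
    (h0 : ∀ s, r ^ 2 ≤ s → χ s = 0) {g : E → Z} (hg : ContDiff ℝ 2 g)
    (hΔ : ∀ y ∈ ball (0 : E) r, Δ g y = 0) {t : ℝ} (ht : t ∈ Set.Icc (0 : ℝ) 1) :
    ∫ y, χ (‖y‖ ^ 2) • fderiv ℝ g (t • y) y ∂μ = 0 := by
  obtain ⟨η, hη0, hη⟩ := exists_primitive_comp_norm_sq (E := E) hχ h0
  have hχc : Continuous fun y : E ↦ χ (‖y‖ ^ 2) := by fun_prop
  have hχs := hasCompactSupport_comp_norm_sq (E := E) hr.le h0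
  have hηc : Continuous fun y : E ↦ η (‖y‖ ^ 2) :=
    continuous_iff_continuousAt.2 fun y ↦ (hη y).continuousAt
  have hηs := hasCompactSupport_comp_norm_sq (E := E) hr.le hη0
  have hg1 : ContDiff ℝ 1 (fderiv ℝ g) := hg.fderiv_right (by norm_num)
  have hg1c : Continuous (fderiv ℝ g) := hg1.continuous
  have hg2c : Continuous (fderiv ℝ (fderiv ℝ g)) := hg1.continuous_fderiv (by norm_num)
  have hint {a : E → ℝ} {b : E → Z} (ha : Continuous a) (has : HasCompactSupport a)
      (hb : Continuous b) : Integrable (fun y ↦ a y • b y) μ :=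
    (ha.smul hb).integrable_of_hasCompactSupport has.smul_right
  set e := stdOrthonormalBasis ℝ E
  have hwt (i) : HasCompactSupport fun y : E ↦ 2 * χ (‖y‖ ^ 2) * inner ℝ y (e i) :=
    (hχs.mul_left (f := fun _ ↦ 2)).mul_right
  have parts (i) : ∫ y, η (‖y‖ ^ 2) • (t • fderiv ℝ (fderiv ℝ g) (t • y) (e i) (e i)) ∂μ
      = - ∫ y, (2 * χ (‖y‖ ^ 2) * inner ℝ y (e i)) • fderiv ℝ g (t • y) (e i) ∂μ := by
    have hd (y : E) : HasFDerivAt (fun y ↦ fderiv ℝ g (t • y) (e i))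
        (((ContinuousLinearMap.apply ℝ Z (e i)).comp (fderiv ℝ (fderiv ℝ g) (t • y))).comp
          (t • ContinuousLinearMap.id ℝ E)) y := by
      have h1 : HasFDerivAt (fun y : E ↦ t • y) (t • ContinuousLinearMap.id ℝ E) y :=
        (hasFDerivAt_id y).const_smul t
      exact ((ContinuousLinearMap.apply ℝ Z (e i)).hasFDerivAt.comp (t • y)
        ((hg1.differentiable (by norm_num)) (t • y)).hasFDerivAt).comp y h1
    have := integral_bilinear_hasFDerivAt_right_eq_neg_left_of_integrable (μ := μ)
      (B := ContinuousLinearMap.lsmul ℝ ℝ) (v := e i)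
      (f := fun y : E ↦ η (‖y‖ ^ 2)) (f' := fun y ↦ (2 * χ (‖y‖ ^ 2)) • innerSL ℝ y)
      (g := fun y ↦ fderiv ℝ g (t • y) (e i)) (g' := fun y ↦
        ((ContinuousLinearMap.apply ℝ Z (e i)).comp (fderiv ℝ (fderiv ℝ g) (t • y))).comp
          (t • ContinuousLinearMap.id ℝ E)) ?_ ?_ ?_ (fun y _ ↦ hη y) (fun y _ ↦ hd y)
    · simpa [smul_comm t] using this
    · simp only [ContinuousLinearMap.lsmul_apply]
      refine hint ?_ ?_ (by fun_prop)
      · simp; fun_prop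
      · simpa using hwt i
    · simp only [ContinuousLinearMap.lsmul_apply]
      refine hint hηc hηs ?_
      simp; fun_prop
    · exact hint hηc hηs (by fun_prop)
  have hsum := Finset.sum_congr (rfl : Finset.univ = Finset.univ) fun i _ ↦ parts i
  rw [Finset.sum_neg_distrib, ← integral_finsetSum _ fun i _ ↦ hint hηc hηs (by fun_prop),
    ← integral_finsetSum _ fun i _ ↦ hint (by fun_prop) (by
      exact hwt i)
      (by fun_prop)] at hsum
  have hl : ∫ y, ∑ i, η (‖y‖ ^ 2) • (t • fderiv ℝ (fderiv ℝ g) (t • y) (e i) (e i)) ∂μ = 0 := by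
    rw [← integral_zero E Z (μ := μ)]
    congr 1 with y
    rw [← Finset.smul_sum, ← Finset.smul_sum]
    by_cases hy : ‖y‖ < r
    · have h1 : t • y ∈ ball (0 : E) r := by
        rw [mem_ball_zero_iff, norm_smul, Real.norm_of_nonneg ht.1]
        exact (mul_le_of_le_one_left (norm_nonneg _) ht.2).trans_lt hy
      have h2 := hΔ _ h1
      simp only [laplacian_eq_iteratedFDeriv_stdOrthonormalBasis, iteratedFDeriv_two_apply] at h2
      simp only [Matrix.cons_val_zero, Matrix.cons_val_one] at h2
      simp [e, h2]
    · rw [hη0 _ (by gcongr; exact not_lt.1 hy), zero_smul]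
  have hrr (y : E) : ∑ i, (2 * χ (‖y‖ ^ 2) * inner ℝ y (e i)) • fderiv ℝ g (t • y) (e i)
      = (2 : ℝ) • (χ (‖y‖ ^ 2) • fderiv ℝ g (t • y) y) := by
    have h1 (T : E →L[ℝ] Z) : T y = ∑ i, inner ℝ y (e i) • T (e i) := by
      conv_lhs => rw [← e.sum_repr' y, map_sum]
      simp [real_inner_comm]
    rw [h1 (fderiv ℝ g (t • y)), Finset.smul_sum, Finset.smul_sum]
    simp only [smul_smul, mul_assoc]
  rw [hl] at hsum
  simp only [hrr, integral_smul] at hsum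
  simpa using hsum.symm

/-- The mean value property for globally defined functions: the weighted average of `y ↦ g (t y)`
does not depend on `t ∈ [0, 1]`, and at `t = 0` it is a multiple of `g 0`. -/
theorem integral_radial_smul_of_hasCompactSupport [CompleteSpace Z] {χ : ℝ → ℝ} (hχ : Continuous χ)
    {r : ℝ} (hr : 0 < r) (h0 : ∀ s, r ^ 2 ≤ s → χ s = 0) {g : E → Z} (hg : ContDiff ℝ 2 g)
    (hgs : HasCompactSupport g) (hΔ : ∀ y ∈ ball (0 : E) r, Δ g y = 0) :
    ∫ y, χ (‖y‖ ^ 2) • g y ∂μ = (∫ y, χ (‖y‖ ^ 2) ∂μ) • g 0 := by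
  have hχc : Continuous fun y : E ↦ χ (‖y‖ ^ 2) := by fun_prop
  have hχs := hasCompactSupport_comp_norm_sq (E := E) hr.le h0
  have hg1c : Continuous (fderiv ℝ g) := hg.continuous_fderiv (by norm_num)
  have hgc : Continuous g := hg.continuous
  obtain ⟨C, hC⟩ := hg1c.bounded_above_of_compact_support (hgs.fderiv (𝕜 := ℝ))
  have hder (t : ℝ) : HasDerivAt (fun t : ℝ ↦ ∫ y, χ (‖y‖ ^ 2) • g (t • y) ∂μ)
      (∫ y, χ (‖y‖ ^ 2) • fderiv ℝ g (t • y) y ∂μ) t := by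
    refine (hasDerivAt_integral_of_dominated_loc_of_deriv_le (s := Set.univ)
      (F := fun (t : ℝ) y ↦ χ (‖y‖ ^ 2) • g (t • y))
      (F' := fun (t : ℝ) y ↦ χ (‖y‖ ^ 2) • fderiv ℝ g (t • y) y)
      (bound := fun y ↦ |χ (‖y‖ ^ 2)| * (C * ‖y‖)) univ_mem ?_ ?_ ?_ ?_ ?_ ?_).2
    · exact .of_forall fun t ↦ (by fun_prop : Continuous _).aestronglyMeasurable
    · exact (by fun_prop : Continuous fun y : E ↦
        χ (‖y‖ ^ 2) • g (t • y)).integrable_of_hasCompactSupport hχs.smul_right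
    · exact (by fun_prop : Continuous _).aestronglyMeasurable
    · refine .of_forall fun y s _ ↦ ?_
      rw [norm_smul, Real.norm_eq_abs]
      gcongr
      exact (fderiv ℝ g (s • y)).le_of_opNorm_le (hC _) _
    · exact (by fun_prop : Continuous fun y : E ↦
        |χ (‖y‖ ^ 2)| * (C * ‖y‖)).integrable_of_hasCompactSupport hχs.norm.mul_right
    · refine .of_forall fun y s _ ↦ ?_
      have h1 : HasDerivAt (fun t : ℝ ↦ t • y) y s := by
        simpa using (hasDerivAt_id s).smul_const y
      exact (((hg.differentiable (by norm_num)) (s • y)).hasFDerivAt.comp_hasDerivAt s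
        h1).const_smul _
  have hconst := constant_of_has_deriv_right_zero (a := 0) (b := 1)
    (fun t _ ↦ (hder t).continuousAt.continuousWithinAt)
    (fun t ht ↦ by
      have := (hder t).hasDerivWithinAt (s := Set.Ici t)
      rwa [integral_radial_smul_fderiv_eq_zero μ hχ hr h0 hg hΔ ⟨ht.1, ht.2.le⟩] at this)
    1 (by simp)
  simpa [integral_smul_const] using hconst

/-- **Mean value property** for radial weights: if `f` is harmonic near `closedBall x r`, its
average around `x` against any continuous radial weight supported in `closedBall 0 r` is a multiple
of `f x`. -/
theorem InnerProductSpace.HarmonicOnNhd.integral_radial_smul [CompleteSpace Z] {χ : ℝ → ℝ}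
    (hχ : Continuous χ) {r R : ℝ} (hr : 0 < r) (hrR : r < R) (h0 : ∀ s, r ^ 2 ≤ s → χ s = 0)
    {f : E → Z} {x : E} (hf : HarmonicOnNhd f (ball x R)) :
    ∫ y, χ (‖y‖ ^ 2) • f (x + y) ∂μ = (∫ y, χ (‖y‖ ^ 2) ∂μ) • f x := by
  -- Cutting `f (x + ·)` off outside `ball 0 r` changes nothing where the weight lives.
  let b : ContDiffBump (0 : E) := ⟨r, (r + R) / 2, hr, by linarith⟩
  let g : E → Z := fun y ↦ b y • f (x + y)
  have hgs : HasCompactSupport g := b.hasCompactSupport.smul_right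
  have hgf {y : E} (hy : y ∈ ball (0 : E) r) : g =ᶠ[𝓝 y] fun y ↦ f (x + y) := by
    filter_upwards [isOpen_ball.mem_nhds hy] with z hz
    simp [g, b.one_of_mem_closedBall (ball_subset_closedBall hz)]
  have hg : ContDiff ℝ 2 g := by
    rw [contDiff_iff_contDiffAt]
    intro y
    by_cases hy : y ∈ tsupport b
    · rw [b.tsupport_eq] at hy
      have h1 : x + y ∈ ball x R := by
        have : ‖y‖ ≤ (r + R) / 2 := by simpa using hy
        rw [mem_ball_iff_norm, add_sub_cancel_left]
        linarith
      have h2 : ContDiffAt ℝ 2 (fun y ↦ f (x + y)) y :=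
        (hf _ h1).1.comp y (by fun_prop)
      exact b.contDiffAt.smul h2
    · have : g =ᶠ[𝓝 y] fun _ ↦ 0 := by
        filter_upwards [(isClosed_tsupport b).isOpen_compl.mem_nhds hy] with z hz
        simp [g, image_eq_zero_of_notMem_tsupport hz]
      exact contDiffAt_const.congr_of_eventuallyEq this
  have hΔ : ∀ y ∈ ball (0 : E) r, Δ g y = 0 := by
    intro y hy
    have h1 : x + y ∈ ball x R := by
      have : ‖y‖ < r := by simpa using hy
      rw [mem_ball_iff_norm, add_sub_cancel_left]
      linarith
    rw [(laplacian_congr_nhds (hgf hy)).eq_of_nhds]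
    have h2 := (hf _ h1).2.eq_of_nhds
    simp only [laplacian_eq_iteratedFDeriv_stdOrthonormalBasis,
      iteratedFDeriv_comp_add_left] at h2 ⊢
    exact h2
  have := integral_radial_smul_of_hasCompactSupport μ hχ hr h0 hg hgs hΔ
  have hg0 : g 0 = f x := by simpa using (hgf (mem_ball_self hr)).eq_of_nhds
  rw [hg0] at this
  rw [← this]
  congr 1 with y
  by_cases hy : ‖y‖ < r
  · rw [(hgf (by simpa using hy)).eq_of_nhds]
  · rw [h0 _ (by gcongr; exact not_lt.1 hy), zero_smul, zero_smul]

/-- The profile of a normalized `C²` radial weight supported in a given ball. -/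
theorem exists_smooth_radial_profile {r : ℝ} (hr : 0 < r) :
    ∃ χ : ℝ → ℝ, ContDiff ℝ 2 χ ∧ (∀ s, r ^ 2 ≤ s → χ s = 0) ∧
      ∫ y : E, χ (‖y‖ ^ 2) ∂μ = 1 := by
  let b : ContDiffBump (0 : ℝ) :=
    ⟨r ^ 2 / 2, r ^ 2, by positivity, by linarith [sq_pos_of_pos hr]⟩
  have hb0 (s) (hs : r ^ 2 ≤ s) : b s = 0 := b.zero_of_le_dist (by
    simpa using hs.trans (le_abs_self s))
  have hpos : 0 < ∫ y : E, b (‖y‖ ^ 2) ∂μ := by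
    refine Continuous.integral_pos_of_hasCompactSupport_nonneg_nonzero (x := 0)
      (b.continuous.comp (by fun_prop)) (hasCompactSupport_comp_norm_sq hr.le hb0)
      (fun _ ↦ b.nonneg) ?_
    simpa using (b.one_of_mem_closedBall (by simp [b.rIn_pos.le]) : b 0 = 1).trans_ne one_ne_zero
  refine ⟨fun s ↦ (∫ y : E, b (‖y‖ ^ 2) ∂μ)⁻¹ * b s, contDiff_const.mul b.contDiff,
    fun s hs ↦ ?_, ?_⟩
  · simp [hb0 s hs]
  · rw [integral_const_mul, inv_mul_cancel₀ hpos.ne']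

end MeanValue

/-! ### Reproducing kernels and their consequences -/

section Kernel

variable {E : Type*} [NormedAddCommGroup E] [InnerProductSpace ℝ E]
  [FiniteDimensional ℝ E] [MeasurableSpace E] [BorelSpace E] (μ : Measure E)
  [μ.IsAddHaarMeasure]

/-- A compactly supported `C²` kernel that reproduces harmonic functions under convolution. -/
theorem exists_reproducing_kernel (Z : Type*) [NormedAddCommGroup Z] [NormedSpace ℝ Z]
    [CompleteSpace Z] {r : ℝ} (hr : 0 < r) :
    ∃ k : E → ℝ, ContDiff ℝ 2 k ∧ HasCompactSupport k ∧ (∀ x, r ≤ ‖x‖ → k x = 0) ∧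
      ∀ (f : E → Z) (x : E) (R : ℝ), r < R → HarmonicOnNhd f (ball x R) →
        ∫ z, k (x - z) • f z ∂μ = f x := by
  obtain ⟨χ, hχ, h0, h1⟩ := exists_smooth_radial_profile (E := E) μ hr
  refine ⟨fun x ↦ χ (‖x‖ ^ 2), hχ.comp (contDiff_norm_sq ℝ),
    hasCompactSupport_comp_norm_sq hr.le h0, fun x hx ↦ h0 _ (by gcongr), fun f x R hR hf ↦ ?_⟩
  have h2 := hf.integral_radial_smul μ hχ.continuous hr hR h0
  rw [h1, one_smul, ← integral_sub_right_eq_self _ x] at h2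
  simpa [norm_sub_rev x] using h2

/-- Local `L¹` bounds on harmonic functions give local uniform bounds and local Lipschitz
estimates: both are read off from the reproducing kernel. -/
theorem exists_uniform_bound_of_locallyIntegrableOn {Z : Type*} [NormedAddCommGroup Z]
    [NormedSpace ℝ Z] [CompleteSpace Z] {ι : Type*} {f : ι → E → Z} {Ω : Set E} (hΩ : IsOpen Ω)
    (hf : ∀ n, HarmonicOnNhd (f n) Ω) {g : E → ℝ} (hg : LocallyIntegrableOn g Ω μ)
    (hfg : ∀ n, ∀ᵐ ξ ∂(μ.restrict Ω), ‖f n ξ‖ ≤ g ξ) {x₀ : E} (hx₀ : x₀ ∈ Ω) :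
    ∃ r > 0, ∃ C, ball x₀ r ⊆ Ω ∧ ∀ n, (∀ x ∈ ball x₀ r, ‖f n x‖ ≤ C) ∧
      ∀ x ∈ ball x₀ r, ∀ y ∈ ball x₀ r, ‖f n x - f n y‖ ≤ C * ‖x - y‖ := by
  obtain ⟨s, hs, hgs⟩ := hg x₀ hx₀
  rw [hΩ.nhdsWithin_eq hx₀] at hs
  obtain ⟨ρ, hρ, hρs⟩ := Metric.mem_nhds_iff.1 (inter_mem hs (hΩ.mem_nhds hx₀))
  -- For `x` within `ρ / 3` of `x₀`, the kernel of radius `ρ / 3` centred at `x` only sees `B`.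
  set B := ball x₀ ρ
  have hBΩ : B ⊆ Ω := fun x hx ↦ (hρs hx).2
  have hgB : IntegrableOn g B μ := hgs.mono_set fun x hx ↦ (hρs hx).1
  have hfgB (n) : ∀ᵐ ξ ∂(μ.restrict B), ‖f n ξ‖ ≤ g ξ :=
    ae_restrict_of_ae_restrict_of_subset hBΩ (hfg n)
  have hfB (n) : IntegrableOn (f n) B μ := by
    refine Integrable.mono' hgB ?_ (hfgB n)
    exact (((hf n).mono hBΩ).continuousOn).aestronglyMeasurable isOpen_ball.measurableSet
  have hr : 0 < ρ / 3 := by positivity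
  obtain ⟨k, hk, hks, hk0, hkf⟩ := exists_reproducing_kernel μ Z hr
  have hkc : Continuous k := hk.continuous
  obtain ⟨M, hM⟩ := hkc.bounded_above_of_compact_support hks
  obtain ⟨L, hL⟩ := hk.lipschitzWith_of_hasCompactSupport hks (by norm_num)
  have hrep (n) {x : E} (hx : x ∈ ball x₀ (ρ / 3)) : f n x = ∫ z in B, k (x - z) • f n z ∂μ := by
    have hx' : dist x x₀ < ρ / 3 := hx
    rw [setIntegral_eq_integral_of_forall_compl_eq_zero]
    · refine (hkf (f n) x (ρ / 3 + ρ / 3) (by linarith) ((hf n).mono ?_)).symm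
      exact (ball_subset_ball' (by linarith)).trans hBΩ
    · intro z hz
      rw [hk0, zero_smul]
      have h1 : ρ ≤ dist z x₀ := by simpa [B] using hz
      have h2 := dist_triangle z x x₀
      rw [← dist_eq_norm, dist_comm]
      linarith
  have hint (n) (x : E) : Integrable (fun z ↦ k (x - z) • f n z) (μ.restrict B) :=
    (hfB n).bdd_smul M (by fun_prop : Continuous fun z ↦ k (x - z)).aestronglyMeasurable
      (.of_forall fun z ↦ hM _)
  refine ⟨ρ / 3, hr, max M L * ∫ z in B, g z ∂μ,
    (ball_subset_ball (by linarith)).trans hBΩ, fun n ↦ ⟨fun x hx ↦ ?_, fun x hx y hy ↦ ?_⟩⟩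
  · rw [hrep n hx, ← integral_const_mul]
    refine norm_integral_le_of_norm_le (hgB.const_mul _) ((hfgB n).mono fun z hz ↦ ?_)
    rw [norm_smul]
    exact mul_le_mul ((hM _).trans (le_max_left _ _)) hz (norm_nonneg _)
      ((L.coe_nonneg).trans (le_max_right _ _))
  · rw [hrep n hx, hrep n hy, ← integral_sub (hint n x) (hint n y), mul_right_comm,
      ← integral_const_mul]
    refine norm_integral_le_of_norm_le (hgB.const_mul _) ((hfgB n).mono fun z hz ↦ ?_)
    rw [← sub_smul, norm_smul]
    have h1 : ‖k (x - z) - k (y - z)‖ ≤ max M L * ‖x - y‖ := by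
      have := hL.norm_sub_le (x - z) (y - z)
      rw [sub_sub_sub_cancel_right] at this
      exact this.trans (by gcongr; exact le_max_right _ _)
    exact mul_le_mul h1 hz (norm_nonneg _) ((norm_nonneg _).trans h1)

/-- A continuous Banach-space valued function is harmonic as soon as its compositions with a
separating family of continuous linear maps are: being reproduced by the kernel is visible through
the family, and it makes the function `C²`. -/
theorem ContinuousOn.harmonicOnNhd_of_separating {Y Z ι : Type*} [NormedAddCommGroup Y]
    [NormedSpace ℝ Y] [CompleteSpace Y] [NormedAddCommGroup Z] [NormedSpace ℝ Z] [CompleteSpace Z]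
    {L : ι → Y →L[ℝ] Z} (hL : ∀ y, (∀ i, L i y = 0) → y = 0) {G : E → Y} {Ω : Set E}
    (hΩ : IsOpen Ω) (hG : ContinuousOn G Ω) (hLG : ∀ i, HarmonicOnNhd (L i ∘ G) Ω) :
    HarmonicOnNhd G Ω := by
  borelize E
  let μ : Measure E := Measure.addHaar
  have hL' (y y') (h : ∀ i, L i y = L i y') : y = y' :=
    sub_eq_zero.1 (hL _ fun i ↦ by rw [map_sub, h i, sub_self])
  have hsmooth : ∀ x₀ ∈ Ω, ContDiffAt ℝ 2 G x₀ := by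
    intro x₀ hx₀
    obtain ⟨ρ, hρ, hρΩ⟩ := Metric.nhds_basis_closedBall.mem_iff.1 (hΩ.mem_nhds hx₀)
    have hr : 0 < ρ / 3 := by positivity
    obtain ⟨k, hk, hks, hk0, hkf⟩ := exists_reproducing_kernel μ Z hr
    have hkc : Continuous k := hk.continuous
    obtain ⟨M, hM⟩ := hkc.bounded_above_of_compact_support hks
    set B := closedBall x₀ ρ
    have hGB : IntegrableOn G B μ := (hG.mono hρΩ).integrableOn_compact (isCompact_closedBall _ _)
    have hGt : Integrable (B.indicator G) μ :=
      (integrable_indicator_iff isClosed_closedBall.measurableSet).2 hGB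
    have hconv : ContDiff ℝ 2 (convolution k (B.indicator G) (ContinuousLinearMap.lsmul ℝ ℝ) μ) :=
      hks.contDiff_convolution_left (n := 2) _ (by exact_mod_cast hk) hGt.locallyIntegrable
    refine hconv.contDiffAt.congr_of_eventuallyEq ?_
    filter_upwards [ball_mem_nhds x₀ hr] with x hx
    have hx' : dist x x₀ < ρ / 3 := hx
    rw [convolution_lsmul_swap]
    -- At `x` the identity `G = k ⋆ G` may be tested through each `L i`, where it is the
    -- reproducing property of `k`.
    refine hL' _ _ fun i ↦ ?_
    have hint : Integrable (fun z ↦ k (x - z) • B.indicator G z) μ :=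
      hGt.bdd_smul M (by fun_prop : Continuous fun z ↦ k (x - z)).aestronglyMeasurable
        (.of_forall fun z ↦ hM _)
    rw [← (L i).integral_comp_comm hint]
    have h1 : HarmonicOnNhd (L i ∘ G) (ball x (ρ / 3 + ρ / 3)) :=
      (hLG i).mono ((ball_subset_ball' (by linarith)).trans (ball_subset_closedBall.trans hρΩ))
    rw [← Function.comp_apply (f := L i) (g := G), ← hkf _ x _ (by linarith) h1]
    congr 1 with z
    by_cases hz : z ∈ B
    · simp [hz]
    · have h2 : ρ < dist z x₀ := by simpa [B] using hz
      have h3 := dist_triangle z x x₀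
      have h4 : ρ / 3 ≤ ‖x - z‖ := by
        rw [← dist_eq_norm, dist_comm]
        linarith
      simp [hk0 _ h4]
  refine fun x hx ↦ ⟨hsmooth x hx, ?_⟩
  filter_upwards [hΩ.mem_nhds hx] with y hy
  refine hL _ fun i ↦ ?_
  have h1 := (hLG i y hy).2.eq_of_nhds
  rwa [(hsmooth y hy).laplacian_CLM_comp_left] at h1

end Kernel

/-- Holomorphy of a continuous function is detected by a separating family of continuous linear
maps, because each of them commutes with the Cauchy integral. -/
theorem ContinuousOn.differentiableOn_complex_of_separating {Y Z ι : Type*} [NormedAddCommGroup Y]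
    [NormedSpace ℂ Y] [CompleteSpace Y] [NormedAddCommGroup Z] [NormedSpace ℂ Z] [CompleteSpace Z]
    {L : ι → Y →L[ℂ] Z} (hL : ∀ y, (∀ i, L i y = 0) → y = 0) {G : ℂ → Y} {Ω : Set ℂ}
    (hΩ : IsOpen Ω) (hG : ContinuousOn G Ω) (hLG : ∀ i, DifferentiableOn ℂ (L i ∘ G) Ω) :
    DifferentiableOn ℂ G Ω := by
  intro c hc
  obtain ⟨R, hR, hRΩ⟩ := Metric.nhds_basis_closedBall.mem_iff.1 (hΩ.mem_nhds hc)
  lift R to NNReal using hR.le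
  have hGc : ContinuousOn G (sphere c R) := hG.mono (sphere_subset_closedBall.trans hRΩ)
  have h1 := hasFPowerSeriesOn_cauchy_integral (hGc.circleIntegrable R.2) (by exact_mod_cast hR)
  refine (h1.analyticAt.differentiableAt.congr_of_eventuallyEq ?_).differentiableWithinAt
  filter_upwards [ball_mem_nhds c hR] with w hw
  refine sub_eq_zero.1 (hL _ fun i ↦ ?_)
  have h2 := ((hLG i).mono hRΩ).circleIntegral_sub_inv_smul hw
  have hint : CircleIntegrable (fun z ↦ (z - w)⁻¹ • G z) c R := by
    refine ContinuousOn.circleIntegrable R.2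
      (ContinuousOn.smul (ContinuousOn.inv₀ (by fun_prop) ?_) hGc)
    intro z hz h
    rw [sub_eq_zero.1 h] at hz
    exact (mem_ball.1 hw).ne (mem_sphere.1 hz)
  have h3 : L i (∮ z in C(c, R), (z - w)⁻¹ • G z) = ∮ z in C(c, R), (z - w)⁻¹ • (L i ∘ G) z := by
    simp only [circleIntegral]
    rw [← (L i).intervalIntegral_comp_comm hint.out]
    simp
  rw [map_sub, map_smul, h3, h2, inv_smul_smul₀ Complex.two_pi_I_ne_zero]
  simp

open scoped BoundedContinuousFunction

/-! ### The space of convergent sequences -/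

section ConvergentSequences

variable (𝕜 : Type*) [RCLike 𝕜] (X : Type*) [NormedAddCommGroup X] [NormedSpace 𝕜 X]

/-- The space `c(X)` of convergent sequences, as a subspace of the space `ℕ →ᵇ X` of bounded
sequences. -/
def convergentSequences : Submodule 𝕜 (ℕ →ᵇ X) where
  carrier := {u | ∃ l, Tendsto u atTop (𝓝 l)}
  add_mem' := by
    rintro u v ⟨l, hl⟩ ⟨m, hm⟩
    exact ⟨l + m, hl.add hm⟩
  zero_mem' := ⟨0, tendsto_const_nhds⟩
  smul_mem' := by
    rintro a u ⟨l, hl⟩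
    exact ⟨a • l, hl.const_smul a⟩

variable {𝕜 X}

theorem isClosed_convergentSequences [CompleteSpace X] :
    IsClosed (convergentSequences 𝕜 X : Set (ℕ →ᵇ X)) := by
  refine isClosed_of_closure_subset fun u hu ↦ ?_
  rw [Metric.mem_closure_iff] at hu
  refine cauchySeq_tendsto_of_complete (Metric.cauchySeq_iff'.2 fun ε hε ↦ ?_)
  obtain ⟨v, ⟨l, hl⟩, huv⟩ := hu (ε / 3) (by positivity)
  obtain ⟨N, hN⟩ := Metric.cauchySeq_iff'.1 hl.cauchySeq (ε / 3) (by positivity)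
  refine ⟨N, fun n hn ↦ ?_⟩
  have h1 := (BoundedContinuousFunction.dist_coe_le_dist (f := u) (g := v) n)
  have h2 := (BoundedContinuousFunction.dist_coe_le_dist (f := u) (g := v) N)
  have h3 := dist_triangle4 (u n) (v n) (v N) (u N)
  rw [dist_comm (v N)] at h3
  linarith [hN n hn]

/-- By Hahn–Banach, membership in `c(X)` is tested by the functionals that annihilate `c(X)`. -/
theorem mem_convergentSequences_of_forall_dual [CompleteSpace X] {u : ℕ →ᵇ X}
    (hu : ∀ φ : StrongDual 𝕜 (ℕ →ᵇ X), (∀ v ∈ convergentSequences 𝕜 X, φ v = 0) → φ u = 0) :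
    u ∈ convergentSequences 𝕜 X := by
  have := isClosed_convergentSequences (𝕜 := 𝕜) (X := X)
  rw [← Submodule.Quotient.mk_eq_zero]
  by_contra h
  -- A functional on the quotient by `c(X)` that is nonzero at the class of `u`.
  obtain ⟨ψ, -, hψ⟩ := exists_dual_vector 𝕜
    (Submodule.Quotient.mk u : _ ⧸ convergentSequences 𝕜 X) (norm_ne_zero_iff.2 h)
  have h1 := hu (ψ.comp (convergentSequences 𝕜 X).mkQL) fun v hv ↦ by
    simp [(Submodule.Quotient.mk_eq_zero _).2 hv]
  simp at h1
  rw [h1] at hψ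
  exact h (by simpa using hψ.symm)

variable (𝕜 X) in
/-- The limit, as a continuous linear map on `c(X)`. -/
noncomputable def limCLM : convergentSequences 𝕜 X →L[𝕜] X :=
  LinearMap.mkContinuous
    { toFun := fun u ↦ u.2.choose
      map_add' := fun u v ↦ tendsto_nhds_unique (u + v).2.choose_spec
        (u.2.choose_spec.add v.2.choose_spec)
      map_smul' := fun a u ↦ tendsto_nhds_unique (a • u).2.choose_spec
        (u.2.choose_spec.const_smul a) } 1 fun u ↦ by
    refine le_of_tendsto u.2.choose_spec.norm (.of_forall fun n ↦ ?_)
    rw [one_mul]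
    exact u.1.norm_coe_le_norm n

theorem tendsto_limCLM (u : convergentSequences 𝕜 X) :
    Tendsto (u : ℕ →ᵇ X) atTop (𝓝 (limCLM 𝕜 X u)) :=
  u.2.choose_spec

end ConvergentSequences

/-! ### Sequences of functions as one sequence-valued function -/

section Sequences

variable {E X : Type*} [PseudoMetricSpace E] [NormedAddCommGroup X]

/-- A sequence of functions that is locally uniformly bounded and locally uniformly Lipschitz is
one continuous function with values in the space of bounded sequences. -/
theorem exists_continuousOn_boundedSequence {f : ℕ → E → X} {Ω : Set E}
    (hf : ∀ x₀ ∈ Ω, ∃ r > 0, ∃ C : ℝ, ball x₀ r ⊆ Ω ∧ ∀ n, (∀ x ∈ ball x₀ r, ‖f n x‖ ≤ C) ∧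
      ∀ x ∈ ball x₀ r, ∀ y ∈ ball x₀ r, ‖f n x - f n y‖ ≤ C * dist x y) :
    ∃ F : E → ℕ →ᵇ X, ContinuousOn F Ω ∧ ∀ x ∈ Ω, ∀ n, F x n = f n x := by
  classical
  -- Off `Ω` the sequence may be unbounded, and the value there is irrelevant.
  let F : E → ℕ →ᵇ X := fun x ↦ if h : ∃ C, ∀ n, ‖f n x‖ ≤ C then
    BoundedContinuousFunction.ofNormedAddCommGroupDiscrete (f · x) h.choose h.choose_spec else 0
  have hF : ∀ x ∈ Ω, ∀ n, F x n = f n x := by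
    intro x hx n
    obtain ⟨r, hr, C, -, hC⟩ := hf x hx
    have : ∃ C, ∀ n, ‖f n x‖ ≤ C := ⟨C, fun n ↦ (hC n).1 x (mem_ball_self hr)⟩
    simp [F, this]
  refine ⟨F, fun x₀ hx₀ ↦ ContinuousAt.continuousWithinAt ?_, hF⟩
  obtain ⟨r, hr, C, hrΩ, hC⟩ := hf x₀ hx₀
  have hlip : LipschitzOnWith C.toNNReal F (ball x₀ r) := by
    refine LipschitzOnWith.of_dist_le_mul fun x hx y hy ↦ ?_
    refine (BoundedContinuousFunction.dist_le (by positivity)).2 fun n ↦ ?_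
    rw [hF x (hrΩ hx), hF y (hrΩ hy), dist_eq_norm]
    exact ((hC n).2 x hx y hy).trans (by gcongr; exact Real.le_coe_toNNReal C)
  exact hlip.continuousOn.continuousAt (ball_mem_nhds _ hr)

/-- If a sequence is encoded by a continuous function with values in the space of bounded sequences,
then it is equicontinuous, so its pointwise convergence is locally uniform. -/
theorem tendstoLocallyUniformlyOn_of_continuousOn_boundedSequence {F : E → ℕ →ᵇ X} {Ω : Set E}
    (hF : ContinuousOn F Ω) {f : ℕ → E → X} (hfF : ∀ x ∈ Ω, ∀ n, F x n = f n x) {f₀ : E → X}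
    (hf₀ : ∀ x ∈ Ω, Tendsto (fun n ↦ f n x) atTop (𝓝 (f₀ x))) :
    TendstoLocallyUniformlyOn f f₀ atTop Ω := by
  rw [Metric.tendstoLocallyUniformlyOn_iff]
  intro ε hε x hx
  refine ⟨Ω ∩ {y | dist (F y) (F x) < ε / 4}, inter_mem self_mem_nhdsWithin
    (hF x hx (Metric.ball_mem_nhds _ (by positivity))), ?_⟩
  have hdist {y} (hy : y ∈ Ω ∩ {y | dist (F y) (F x) < ε / 4}) (n) :
      dist (f n y) (f n x) ≤ ε / 4 := by
    rw [← hfF y hy.1, ← hfF x hx]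
    exact (BoundedContinuousFunction.dist_coe_le_dist n).trans hy.2.le
  filter_upwards [(Metric.tendsto_nhds.1 (hf₀ x hx)) (ε / 4) (by positivity)] with n hn y hy
  have h1 : dist (f₀ y) (f₀ x) ≤ ε / 4 :=
    le_of_tendsto ((hf₀ y hy.1).dist (hf₀ x hx)) (.of_forall (hdist hy))
  have h2 := dist_triangle4 (f₀ y) (f₀ x) (f n x) (f n y)
  rw [dist_comm (f₀ x) (f n x), dist_comm (f n x) (f n y)] at h2
  linarith [hdist hy n]

end Sequences

theorem BoundedContinuousFunction.eq_zero_of_forall_evalCLM {𝕜 X : Type*} [RCLike 𝕜]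
    [NormedAddCommGroup X] [NormedSpace 𝕜 X] (u : ℕ →ᵇ X)
    (hu : ∀ n, BoundedContinuousFunction.evalCLM 𝕜 n u = 0) : u = 0 :=
  BoundedContinuousFunction.ext hu

/-! ### Vitali's theorem -/

theorem vitali_holomorphic {X : Type*} [NormedAddCommGroup X] [NormedSpace ℂ X] [CompleteSpace X]
    {Ω N : Set ℂ} {f : ℕ → ℂ → X} (hΩ : IsOpen Ω) (hf : ∀ n, DifferentiableOn ℂ (f n) Ω)
    (hfb : LocallyL1Bounded f Ω) (hN : IsHolomorphicUniquenessSet N Ω)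
    (hlim : ∀ z ∈ N, ∃ l : X, Tendsto (fun n ↦ f n z) atTop (𝓝 l)) :
    ∃ F : ℂ → X, DifferentiableOn ℂ F Ω ∧
      ∀ K ⊆ Ω, IsCompact K → TendstoUniformlyOn f F atTop K := by
  obtain ⟨g, hg, hfg⟩ := hfb
  obtain ⟨F, hFc, hFf⟩ := exists_continuousOn_boundedSequence (f := f) (Ω := Ω) fun x₀ hx₀ ↦ by
    simpa only [dist_eq_norm] using exists_uniform_bound_of_locallyIntegrableOn volume hΩ
      (fun n x hx ↦ ((hf n).analyticAt (hΩ.mem_nhds hx)).harmonicAt) hg hfg hx₀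
  have hFd : DifferentiableOn ℂ F Ω :=
    hFc.differentiableOn_complex_of_separating
      (L := fun n : ℕ ↦ BoundedContinuousFunction.evalCLM ℂ n)
      BoundedContinuousFunction.eq_zero_of_forall_evalCLM hΩ
      fun n ↦ (hf n).congr fun z hz ↦ by simp [hFf z hz n]
  have hFmem : ∀ z ∈ Ω, F z ∈ convergentSequences ℂ X := fun z hz ↦
    mem_convergentSequences_of_forall_dual fun φ hφ ↦
      hN.2 (φ ∘ F) (φ.differentiable.comp_differentiableOn hFd) (fun w hw ↦ hφ _ (by
        obtain ⟨l, hl⟩ := hlim w hw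
        exact ⟨l, by simpa only [funext (hFf w (hN.1 hw))] using hl⟩)) z hz
  choose! f₀ hf₀ using hFmem
  have hloc : TendstoLocallyUniformlyOn f f₀ atTop Ω :=
    tendstoLocallyUniformlyOn_of_continuousOn_boundedSequence hFc hFf fun z hz ↦ by
      simpa only [funext (hFf z hz)] using hf₀ z hz
  exact ⟨f₀, hloc.differentiableOn (.of_forall hf) hΩ,
    (tendstoLocallyUniformlyOn_iff_forall_isCompact hΩ).1 hloc⟩

theorem vitali_harmonic {X : Type*} [NormedAddCommGroup X] [NormedSpace ℝ X] [CompleteSpace X]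
    {d : ℕ} {Ω N : Set (EuclideanSpace ℝ (Fin d))} {f : ℕ → EuclideanSpace ℝ (Fin d) → X}
    (hΩ : IsOpen Ω) (hf : ∀ n, HarmonicOnNhd (f n) Ω) (hfb : LocallyL1Bounded f Ω)
    (hN : IsHarmonicUniquenessSet N Ω)
    (hlim : ∀ ξ ∈ N, ∃ l : X, Tendsto (fun n ↦ f n ξ) atTop (𝓝 l)) :
    ∃ F : EuclideanSpace ℝ (Fin d) → X, HarmonicOnNhd F Ω ∧
      ∀ K ⊆ Ω, IsCompact K → TendstoUniformlyOn f F atTop K := by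
  classical
  obtain ⟨g, hg, hfg⟩ := hfb
  obtain ⟨F, hFc, hFf⟩ := exists_continuousOn_boundedSequence (f := f) (Ω := Ω) fun x₀ hx₀ ↦ by
    simpa only [dist_eq_norm] using
      exists_uniform_bound_of_locallyIntegrableOn volume hΩ hf hg hfg hx₀
  have hFh : HarmonicOnNhd F Ω :=
    hFc.harmonicOnNhd_of_separating
      (L := fun n : ℕ ↦ BoundedContinuousFunction.evalCLM ℝ n)
      BoundedContinuousFunction.eq_zero_of_forall_evalCLM hΩ
      fun n x hx ↦ (harmonicAt_congr_nhds (by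
        filter_upwards [hΩ.mem_nhds hx] with y hy using hFf y hy n)).2 (hf n x hx)
  have hFmem : ∀ z ∈ Ω, F z ∈ convergentSequences ℝ X := fun z hz ↦
    mem_convergentSequences_of_forall_dual fun φ hφ ↦
      hN.2 (φ ∘ F) (hFh.comp_CLM φ) (fun w hw ↦ hφ _ (by
        obtain ⟨l, hl⟩ := hlim w hw
        exact ⟨l, by simpa only [funext (hFf w (hN.1 hw))] using hl⟩)) z hz
  -- Regarding `F` as a `c(X)`-valued function makes the limit of `f n` a continuous linear image
  -- of a harmonic function.
  let G : EuclideanSpace ℝ (Fin d) → convergentSequences ℝ X := fun x ↦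
    if h : F x ∈ convergentSequences ℝ X then ⟨F x, h⟩ else 0
  have hGF : ∀ x ∈ Ω, (G x : ℕ →ᵇ X) = F x := fun x hx ↦ by simp [G, hFmem x hx]
  have hGc : ContinuousOn G Ω :=
    continuousOn_iff_continuous_domRestrict.2 <| Topology.IsInducing.subtypeVal.continuous_iff.2 <|
      continuousOn_iff_continuous_domRestrict.1 (hFc.congr hGF)
  have : CompleteSpace (convergentSequences ℝ X) :=
    (isClosed_convergentSequences (𝕜 := ℝ) (X := X)).completeSpace_coe
  have hGh : HarmonicOnNhd G Ω :=
    hGc.harmonicOnNhd_of_separating (L := fun _ : Unit ↦ (convergentSequences ℝ X).subtypeL)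
      (fun u hu ↦ Subtype.ext (hu ())) hΩ
      fun _ x hx ↦ (harmonicAt_congr_nhds (by
        filter_upwards [hΩ.mem_nhds hx] with y hy using hGF y hy)).2 (hFh x hx)
  have hloc : TendstoLocallyUniformlyOn f (limCLM ℝ X ∘ G) atTop Ω :=
    tendstoLocallyUniformlyOn_of_continuousOn_boundedSequence hFc hFf fun z hz ↦ by
      simpa only [hGF z hz, funext (hFf z hz), Function.comp_apply] using tendsto_limCLM (G z)
  exact ⟨_, hGh.comp_CLM _, (tendstoLocallyUniformlyOn_iff_forall_isCompact hΩ).1 hloc⟩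

end

theorem mainTheorem9 :
    (∀ (X : Type*) [NormedAddCommGroup X] [NormedSpace ℂ X] [CompleteSpace X]
      (Ω N : Set ℂ) (f : ℕ → ℂ → X),
      IsOpen Ω → IsPreconnected Ω →
      (∀ n, DifferentiableOn ℂ (f n) Ω) →
      LocallyL1Bounded f Ω →
      IsHolomorphicUniquenessSet N Ω →
      (∀ z ∈ N, ∃ l : X, Tendsto (fun n => f n z) atTop (𝓝 l)) →
      ∃ F : ℂ → X, DifferentiableOn ℂ F Ω ∧
        ∀ K ⊆ Ω, IsCompact K → TendstoUniformlyOn f F atTop K) ∧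
    (∀ (X : Type*) [NormedAddCommGroup X] [NormedSpace ℝ X] [CompleteSpace X]
      (d : ℕ) (Ω N : Set (EuclideanSpace ℝ (Fin d))) (f : ℕ → EuclideanSpace ℝ (Fin d) → X),
      IsOpen Ω → IsPreconnected Ω →
      (∀ n, InnerProductSpace.HarmonicOnNhd (f n) Ω) →
      LocallyL1Bounded f Ω →
      IsHarmonicUniquenessSet N Ω →
      (∀ ξ ∈ N, ∃ l : X, Tendsto (fun n => f n ξ) atTop (𝓝 l)) →
      ∃ F : EuclideanSpace ℝ (Fin d) → X, InnerProductSpace.HarmonicOnNhd F Ω ∧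
        ∀ K ⊆ Ω, IsCompact K → TendstoUniformlyOn f F atTop K) :=
  ⟨fun _ _ _ _ _ _ _ hΩ _ hf hfb hN hlim ↦ vitali_holomorphic hΩ hf hfb hN hlim,
    fun _ _ _ _ _ _ _ _ hΩ _ hf hfb hN hlim ↦ vitali_harmonic hΩ hf hfb hN hlim⟩
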